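/- A multiplicative Lie algebra is a group $G$ with a second binary operation $\star$ such that, writing ${}^xy=xyx^{-1}$, for all $x,y,z$: $x\star x=1$; $x\star(yz)=(x\star y)\,{}^y(x\star z)$; $(xy)\star z={}^x(y\star z)\,(x\star z)$; $((x\star y)\star{}^yz)((y\star z)\star{}^zx)((z\star x)\star{}^xy)=1$; ${}^z(x\star y)={}^zx\star{}^zy$. An ideal $H$ of $G$ is a normal subgroup with $x\star y\in H$ for $x\in G$, $y\in H$; put ${}^M[G,H]=(G\star H)[G,H]$, where $G\star H$ is the subgroup generated by all $g\star h$ ($g\in G$, $h\in H$). $G$ is perfect if ${}^M[G,G]=G$. Put $\mathcal Z(G)=\{x\in Z(G): x\star y=1\text{ for all }y\in G\}$; an ideal is central if it is contained in $\mathcal Z(G)$. The Schur multiplier of $G$ is $\tilde M(G)=({}^M[F,F]\cap R)/{}^M[R,F]$, where ${}^M[R,F]$ means ${}^M[F,R]$ and $1\to R\to F\to G\to 1$ is a free presentation of $G$ (we take $F$ to be the free multiplicative Lie algebra on the underlying set of $G$). A surjective homomorphism $\varphi:E\to G$ is a stem cover, and $E$ a cover of $G$, if $\ker\varphi\subseteq\mathcal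 Z(E)\cap{}^M[E,E]$ and $\ker\varphi\cong\tilde M(G)$. For an abelian group $A$ (with trivial Lie product), $Z^2_{ML}(G,A)$ is the group, under pointwise multiplication, of all pairs of maps $f,h:G\times G\to A$ with $f(1,x)=f(x,1)=1$ for which $(a,x)(b,y)=(ab\,f(x,y),xy)$ and $(a,x)\star(b,y)=(h(x,y),x\star y)$ make $A\times G$ a multiplicative Lie algebra; $B^2_{ML}(G,A)$ is the subgroup of pairs $f(x,y)=g(x)g(y)g(xy)^{-1}$, $h(x,y)=g(x\star y)^{-1}$ with $g:G\to A$, $g(1)=1$; and $H^2_{ML}(G,A)=Z^2_{ML}(G,A)/B^2_{ML}(G,A)$. Theorem. Let $G$ be a finite perfect multiplicative Lie algebra with $\tilde M(G)=1$. Then: (i) $H^2_{ML}(G,A)=1$ for every abelian group $A$ with trivial Lie product. (ii) For every central ideal $N$ of $G$, $N\cong\tilde M(G/N)$ as multiplicative Lie algebras, and the quotient map $G\to G/N$ is a stem cover; in particular $G$ is a cover of $G/N$. -/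

import Mathlib

/-- A multiplicative Lie algebra: a (not necessarily abelian) group with a second binary operation
`⋆` satisfying the five identities of Ellis. Here `x * y * x⁻¹` is the conjugate `ˣy`. -/
class MulLieAlgebra (G : Type*) extends Group G where
  /-- the multiplicative Lie product -/
  lieMul : G → G → G
  lieMul_self : ∀ x, lieMul x x = 1
  lieMul_mul : ∀ x y z, lieMul x (y * z) = lieMul x y * (y * lieMul x z * y⁻¹)
  mul_lieMul : ∀ x y z, lieMul (x * y) z = (x * lieMul y z * x⁻¹) * lieMul x z
  jacobi : ∀ x y z,
    lieMul (lieMul x y) (y * z * y⁻¹) * lieMul (lieMul y z) (z * x * z⁻¹) *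
      lieMul (lieMul z x) (x * y * x⁻¹) = 1
  conj_lieMul : ∀ x y z,
    z * lieMul x y * z⁻¹ = lieMul (z * x * z⁻¹) (z * y * z⁻¹)

infixl:70 " ⋆ " => MulLieAlgebra.lieMul

namespace MulLieAlgebra

section Basic

variable {G : Type*} [MulLieAlgebra G]

theorem lieMul_swap_mul (x y : G) : (y ⋆ x) * (x ⋆ y) = 1 := by
  have h := lieMul_self (x * y)
  rw [mul_lieMul, lieMul_mul, lieMul_mul, lieMul_self, lieMul_self] at h
  have h2 : x * ((y ⋆ x) * (x ⋆ y)) * x⁻¹ = 1 := by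
    rw [← h]; group
  have h3 := congrArg (fun t => x⁻¹ * t * x) h2
  simpa [mul_assoc] using h3

theorem lieMul_swap (x y : G) : y ⋆ x = (x ⋆ y)⁻¹ :=
  eq_inv_of_mul_eq_one_left (lieMul_swap_mul x y)

theorem lieMul_one (x : G) : x ⋆ 1 = 1 := by
  have h := lieMul_mul x 1 1
  simpa using h

theorem lieMul_inv (x y : G) : x ⋆ y⁻¹ = y⁻¹ * (x ⋆ y)⁻¹ * y := by
  have h := lieMul_mul x y⁻¹ y
  rw [inv_mul_cancel, lieMul_one] at h
  rw [eq_inv_of_mul_eq_one_left h.symm]; group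

end Basic

/-- An ideal of a multiplicative Lie algebra: a normal subgroup `H` with `x ⋆ y ∈ H` for all
`x ∈ G` and `y ∈ H`. -/
structure Ideal (G : Type*) [MulLieAlgebra G] extends Subgroup G where
  normal : toSubgroup.Normal
  lieMul_mem : ∀ (x : G) {y : G}, y ∈ toSubgroup → x ⋆ y ∈ toSubgroup

namespace Ideal

variable {G : Type*} [MulLieAlgebra G]

instance (I : Ideal G) : I.toSubgroup.Normal := I.normal

theorem lieMul_mem_left (I : Ideal G) {x : G} (hx : x ∈ I.toSubgroup) (y : G) :
    x ⋆ y ∈ I.toSubgroup := by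
  rw [lieMul_swap y x]
  exact inv_mem (I.lieMul_mem y hx)

/-- The whole algebra, as an ideal. -/
def whole (G : Type*) [MulLieAlgebra G] : Ideal G where
  toSubgroup := ⊤
  normal := inferInstance
  lieMul_mem _ _ _ := trivial

/-- The intersection of two ideals. -/
def inter (I J : Ideal G) : Ideal G where
  toSubgroup := I.toSubgroup ⊓ J.toSubgroup
  normal := inferInstance
  lieMul_mem x _ hy := ⟨I.lieMul_mem x hy.1, J.lieMul_mem x hy.2⟩

/-- An ideal is itself a multiplicative Lie algebra under the restricted operations. -/
instance (I : Ideal G) : MulLieAlgebra I.toSubgroup where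
  lieMul x y := ⟨(x : G) ⋆ (y : G), I.lieMul_mem x y.2⟩
  lieMul_self x := Subtype.ext (lieMul_self (x : G))
  lieMul_mul x y z := Subtype.ext (lieMul_mul (x : G) y z)
  mul_lieMul x y z := Subtype.ext (mul_lieMul (x : G) y z)
  jacobi x y z := Subtype.ext (jacobi (x : G) y z)
  conj_lieMul x y z := Subtype.ext (conj_lieMul (x : G) y z)

/-- The intersection `J ∩ I`, viewed as an ideal of the multiplicative Lie algebra `I`. -/
def restrict (J I : Ideal G) : Ideal I.toSubgroup where
  toSubgroup := J.toSubgroup.subgroupOf I.toSubgroup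
  normal := inferInstance
  lieMul_mem x y hy := by
    rw [Subgroup.mem_subgroupOf] at hy ⊢
    exact J.lieMul_mem (x : G) hy

theorem lieMul_congr (I : Ideal G) {a b c d : G} (h : a⁻¹ * b ∈ I.toSubgroup)
    (h' : c⁻¹ * d ∈ I.toSubgroup) : (a ⋆ c)⁻¹ * (b ⋆ d) ∈ I.toSubgroup := by
  obtain ⟨m, hm, rfl⟩ : ∃ m ∈ I.toSubgroup, b = a * m := ⟨_, h, by group⟩
  obtain ⟨n, hn, rfl⟩ : ∃ n ∈ I.toSubgroup, d = c * n := ⟨_, h', by group⟩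
  have h1 : (a ⋆ c)⁻¹ * (a ⋆ (c * n)) ∈ I.toSubgroup := by
    rw [lieMul_mul, inv_mul_cancel_left]
    exact I.normal.conj_mem _ (I.lieMul_mem a hn) c
  have h2 : (a ⋆ (c * n))⁻¹ * ((a * m) ⋆ (c * n)) ∈ I.toSubgroup := by
    rw [mul_lieMul]
    have := I.normal.conj_mem _
      (I.normal.conj_mem _ (I.lieMul_mem_left hm (c * n)) a) (a ⋆ (c * n))⁻¹
    simpa [mul_assoc] using this
  have := mul_mem h1 h2
  simpa [mul_assoc] using this

/-- The quotient of a multiplicative Lie algebra by an ideal. -/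
instance quotient (I : Ideal G) : MulLieAlgebra (G ⧸ I.toSubgroup) where
  lieMul := Quotient.map₂ (fun x y => x ⋆ y) (by
    intro a b h c d h'
    rw [← Quotient.eq_iff_equiv] at h h' ⊢
    exact QuotientGroup.eq.mpr
      (I.lieMul_congr (QuotientGroup.eq.mp h) (QuotientGroup.eq.mp h')))
  lieMul_self x := by
    induction x using QuotientGroup.induction_on with
    | H x => exact congrArg (QuotientGroup.mk (s := I.toSubgroup)) (lieMul_self x)
  lieMul_mul x y z := by
    induction x using QuotientGroup.induction_on
    induction y using QuotientGroup.induction_on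
    induction z using QuotientGroup.induction_on
    exact congrArg (QuotientGroup.mk (s := I.toSubgroup)) (lieMul_mul _ _ _)
  mul_lieMul x y z := by
    induction x using QuotientGroup.induction_on
    induction y using QuotientGroup.induction_on
    induction z using QuotientGroup.induction_on
    exact congrArg (QuotientGroup.mk (s := I.toSubgroup)) (mul_lieMul _ _ _)
  jacobi x y z := by
    induction x using QuotientGroup.induction_on
    induction y using QuotientGroup.induction_on
    induction z using QuotientGroup.induction_on
    exact congrArg (QuotientGroup.mk (s := I.toSubgroup)) (jacobi _ _ _)
  conj_lieMul x y z := by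
    induction x using QuotientGroup.induction_on
    induction y using QuotientGroup.induction_on
    induction z using QuotientGroup.induction_on
    exact congrArg (QuotientGroup.mk (s := I.toSubgroup)) (conj_lieMul _ _ _)

/-- The subgroup `G ⋆ H` generated by all `g ⋆ h` with `g ∈ G`, `h ∈ H`. -/
def starSubgroup (H : Ideal G) : Subgroup G :=
  Subgroup.closure {t | ∃ g h : G, h ∈ H.toSubgroup ∧ t = g ⋆ h}

instance starSubgroup_normal (H : Ideal G) : (starSubgroup H).Normal := by
  refine ⟨fun n hn z => ?_⟩
  have h1 : starSubgroup H ≤ (starSubgroup H).comap (MulAut.conj z).toMonoidHom := by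
    refine (Subgroup.closure_le _).mpr ?_
    rintro _ ⟨g, h, hh, rfl⟩
    exact Subgroup.subset_closure
      ⟨z * g * z⁻¹, z * h * z⁻¹, H.normal.conj_mem _ hh z, conj_lieMul g h z⟩
  exact h1 hn

/-- The ideal `ᴹ[G, H] = (G ⋆ H)[G, H]` attached to an ideal `H` of `G`; since both factors are
normal subgroups, their product is their join. -/
def mBracket (H : Ideal G) : Ideal G where
  toSubgroup := starSubgroup H ⊔ ⁅(⊤ : Subgroup G), H.toSubgroup⁆
  normal := inferInstance
  lieMul_mem x y hy := by
    refine (le_sup_left : starSubgroup H ≤ _) (Subgroup.subset_closure ⟨x, y, ?_, rfl⟩)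
    refine (sup_le ?_ ?_ : starSubgroup H ⊔ ⁅(⊤ : Subgroup G), H.toSubgroup⁆ ≤ H.toSubgroup) hy
    · refine (Subgroup.closure_le _).mpr ?_
      rintro _ ⟨g, h, hh, rfl⟩
      exact H.lieMul_mem g hh
    · exact Subgroup.commutator_le_right _ _

end Ideal

/-- The Lie center `LZ(G)`, as a set. -/
def lieCenter (G : Type*) [MulLieAlgebra G] : Set G := {x | ∀ y : G, x ⋆ y = 1}

/-- An ideal is central if it is contained in `Z(G) ∩ LZ(G)`. -/
def Ideal.IsCentral {G : Type*} [MulLieAlgebra G] (N : Ideal G) : Prop :=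
  (N.toSubgroup : Set G) ⊆ (Subgroup.center G : Set G) ∩ lieCenter G

/-- `G` is perfect if `(G ⋆ G)[G, G] = G`. -/
def IsPerfect (G : Type*) [MulLieAlgebra G] : Prop :=
  (Ideal.whole G).mBracket.toSubgroup = ⊤

/-- Homomorphisms of multiplicative Lie algebras. -/
structure Hom (G H : Type*) [MulLieAlgebra G] [MulLieAlgebra H] extends G →* H where
  map_lieMul : ∀ x y : G, toFun (x ⋆ y) = toFun x ⋆ toFun y

/-- Isomorphisms of multiplicative Lie algebras. -/
structure Iso (G H : Type*) [MulLieAlgebra G] [MulLieAlgebra H] extends G ≃* H where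
  map_lieMul : ∀ x y : G, toFun (x ⋆ y) = toFun x ⋆ toFun y

/-- The kernel of a homomorphism, as an ideal. -/
def Hom.ker {G H : Type*} [MulLieAlgebra G] [MulLieAlgebra H] (f : Hom G H) : Ideal G where
  toSubgroup := f.toMonoidHom.ker
  normal := inferInstance
  lieMul_mem x y hy := by
    have h1 : f.toMonoidHom y = 1 := hy
    have h2 : f.toMonoidHom (x ⋆ y) = f.toMonoidHom x ⋆ f.toMonoidHom y := f.map_lieMul x y
    rw [MonoidHom.mem_ker, h2, h1, lieMul_one]

/-- The quotient homomorphism `G → G / N`. -/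
def Ideal.proj {G : Type*} [MulLieAlgebra G] (N : Ideal G) : Hom G (G ⧸ N.toSubgroup) where
  toMonoidHom := QuotientGroup.mk' N.toSubgroup
  map_lieMul _ _ := rfl

/-! ### Free multiplicative Lie algebras -/

/-- Formal expressions in the operations of a multiplicative Lie algebra. -/
inductive FreeTerm (X : Type*)
  | of : X → FreeTerm X
  | one : FreeTerm X
  | mul : FreeTerm X → FreeTerm X → FreeTerm X
  | inv : FreeTerm X → FreeTerm X
  | lie : FreeTerm X → FreeTerm X → FreeTerm X

namespace FreeTerm

/-- Formal conjugation `ˣy`. -/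
def conj {X : Type*} (x y : FreeTerm X) : FreeTerm X := (x.mul y).mul x.inv

/-- The congruence on formal expressions generated by the axioms of multiplicative Lie algebras. -/
inductive Rel {X : Type*} : FreeTerm X → FreeTerm X → Prop
  | refl (a : FreeTerm X) : Rel a a
  | symm {a b : FreeTerm X} : Rel a b → Rel b a
  | trans {a b c : FreeTerm X} : Rel a b → Rel b c → Rel a c
  | mul_congr {a b c d : FreeTerm X} : Rel a b → Rel c d → Rel (a.mul c) (b.mul d)
  | inv_congr {a b : FreeTerm X} : Rel a b → Rel a.inv b.inv
  | lie_congr {a b c d : FreeTerm X} : Rel a b → Rel c d → Rel (a.lie c) (b.lie d)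
  | mul_assoc (a b c : FreeTerm X) : Rel ((a.mul b).mul c) (a.mul (b.mul c))
  | one_mul (a : FreeTerm X) : Rel (one.mul a) a
  | mul_one (a : FreeTerm X) : Rel (a.mul one) a
  | inv_mul_cancel (a : FreeTerm X) : Rel (a.inv.mul a) one
  | lie_self (a : FreeTerm X) : Rel (a.lie a) one
  | lie_mul (a b c : FreeTerm X) : Rel (a.lie (b.mul c)) ((a.lie b).mul (b.conj (a.lie c)))
  | mul_lie (a b c : FreeTerm X) : Rel ((a.mul b).lie c) ((a.conj (b.lie c)).mul (a.lie c))
  | jacobi (a b c : FreeTerm X) : Rel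
      ((((a.lie b).lie (b.conj c)).mul ((b.lie c).lie (c.conj a))).mul ((c.lie a).lie (a.conj b)))
      one
  | conj_lie (a b c : FreeTerm X) : Rel (c.conj (a.lie b)) ((c.conj a).lie (c.conj b))

/-- The congruence as a setoid. -/
def setoid (X : Type*) : Setoid (FreeTerm X) := ⟨Rel, Rel.refl, Rel.symm, Rel.trans⟩

/-- Evaluation of formal expressions. -/
def eval {X G : Type*} [MulLieAlgebra G] (f : X → G) : FreeTerm X → G
  | of x => f x
  | one => 1
  | mul a b => a.eval f * b.eval f
  | inv a => (a.eval f)⁻¹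
  | lie a b => a.eval f ⋆ b.eval f

theorem Rel.eval_eq {X G : Type*} [MulLieAlgebra G] (f : X → G) {a b : FreeTerm X}
    (h : Rel a b) : a.eval f = b.eval f := by
  induction h with
  | refl => rfl
  | symm _ ih => exact ih.symm
  | trans _ _ ih ih' => exact ih.trans ih'
  | mul_congr _ _ ih ih' => exact congrArg₂ (· * ·) ih ih'
  | inv_congr _ ih => exact congrArg (·⁻¹) ih
  | lie_congr _ _ ih ih' => exact congrArg₂ (· ⋆ ·) ih ih'
  | mul_assoc => exact _root_.mul_assoc _ _ _
  | one_mul => exact _root_.one_mul _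
  | mul_one => exact _root_.mul_one _
  | inv_mul_cancel => exact _root_.inv_mul_cancel _
  | lie_self => exact lieMul_self _
  | lie_mul => exact lieMul_mul _ _ _
  | mul_lie => exact mul_lieMul _ _ _
  | jacobi => exact MulLieAlgebra.jacobi _ _ _
  | conj_lie => exact conj_lieMul _ _ _

end FreeTerm

/-- The free multiplicative Lie algebra on a set `X`. -/
def Free (X : Type*) : Type _ := Quotient (FreeTerm.setoid X)

namespace Free

variable {X : Type*}

instance : MulLieAlgebra (Free X) where
  mul := Quotient.map₂ FreeTerm.mul fun _ _ h _ _ h' => FreeTerm.Rel.mul_congr h h'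
  one := Quotient.mk _ FreeTerm.one
  inv := Quotient.map FreeTerm.inv fun _ _ h => FreeTerm.Rel.inv_congr h
  lieMul := Quotient.map₂ FreeTerm.lie fun _ _ h _ _ h' => FreeTerm.Rel.lie_congr h h'
  mul_assoc := by
    rintro ⟨a⟩ ⟨b⟩ ⟨c⟩; exact Quotient.sound (FreeTerm.Rel.mul_assoc a b c)
  one_mul := by rintro ⟨a⟩; exact Quotient.sound (FreeTerm.Rel.one_mul a)
  mul_one := by rintro ⟨a⟩; exact Quotient.sound (FreeTerm.Rel.mul_one a)
  inv_mul_cancel := by rintro ⟨a⟩; exact Quotient.sound (FreeTerm.Rel.inv_mul_cancel a)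
  lieMul_self := by rintro ⟨a⟩; exact Quotient.sound (FreeTerm.Rel.lie_self a)
  lieMul_mul := by
    rintro ⟨a⟩ ⟨b⟩ ⟨c⟩; exact Quotient.sound (FreeTerm.Rel.lie_mul a b c)
  mul_lieMul := by
    rintro ⟨a⟩ ⟨b⟩ ⟨c⟩; exact Quotient.sound (FreeTerm.Rel.mul_lie a b c)
  jacobi := by
    rintro ⟨a⟩ ⟨b⟩ ⟨c⟩; exact Quotient.sound (FreeTerm.Rel.jacobi a b c)
  conj_lieMul := by
    rintro ⟨a⟩ ⟨b⟩ ⟨c⟩; exact Quotient.sound (FreeTerm.Rel.conj_lie a b c)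

/-- The generators. -/
def of (x : X) : Free X := Quotient.mk _ (FreeTerm.of x)

/-- The homomorphism out of the free multiplicative Lie algebra extending a given map. -/
def lift {G : Type*} [MulLieAlgebra G] (f : X → G) : Hom (Free X) G where
  toFun := Quotient.lift (FreeTerm.eval f) fun _ _ h => FreeTerm.Rel.eval_eq f h
  map_one' := rfl
  map_mul' := by rintro ⟨a⟩ ⟨b⟩; rfl
  map_lieMul := by rintro ⟨a⟩ ⟨b⟩; rfl

end Free

/-! ### The Schur multiplier and covers -/

/-- For a homomorphism `π : F → G` with kernel `R`, the quotient
`(ᴹ[F, F] ∩ R) / ᴹ[F, R]` (note `ᴹ[F, R] ⊆ ᴹ[F, F] ∩ R`). -/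
abbrev HopfQuotient {F G : Type*} [MulLieAlgebra F] [MulLieAlgebra G] (π : Hom F G) : Type _ :=
  ((Ideal.whole F).mBracket.inter π.ker).toSubgroup ⧸
    (π.ker.mBracket.restrict ((Ideal.whole F).mBracket.inter π.ker)).toSubgroup

/-- The Schur multiplier `M̃(G) = (ᴹ[F, F] ∩ R) / ᴹ[R, F]`, computed from the free presentation
`1 → R → F → G → 1` in which `F` is free on the underlying set of `G`. -/
abbrev SchurMultiplier (G : Type*) [MulLieAlgebra G] : Type _ :=
  HopfQuotient (Free.lift (id : G → G))

/-- `φ : E → G` is a stem cover: `1 → ker φ → E → G → 1` is a central extension,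
`ker φ ⊆ ᴹ[E, E]`, and `ker φ ≅ M̃(G)`. -/
structure IsStemCover {E G : Type*} [MulLieAlgebra E] [MulLieAlgebra G] (φ : Hom E G) : Prop where
  surjective : Function.Surjective φ.toMonoidHom
  central : φ.ker.IsCentral
  stem : φ.ker.toSubgroup ≤ (Ideal.whole E).mBracket.toSubgroup
  iso : Nonempty (Iso φ.ker.toSubgroup (SchurMultiplier G))

/-- `E` is a cover of `G`. -/
def IsCover (E G : Type*) [MulLieAlgebra E] [MulLieAlgebra G] : Prop :=
  ∃ φ : Hom E G, IsStemCover φ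

/-! ### Second cohomology -/

section Cohomology

variable (G : Type*) [MulLieAlgebra G] (A : Type*) [CommGroup A]

/-- The `A`-component of the conjugate of `(1, y)` by `(1, x)` in the extension of `G` by `A`
with factor set `f`. -/
def conjFactor {G A : Type*} [Group G] [CommGroup A] (f : G → G → A) (x y : G) : A :=
  f x y * f (x * y) x⁻¹ * (f x x⁻¹)⁻¹

/-- A normalized multiplicative Lie 2-cocycle `(f, h)` of `G` with coefficients in the abelian
group `A` with trivial Lie product. The identities say that
`(a, x) (b, y) = (a b f(x, y), x y)` and `(a, x) ⋆ (b, y) = (h(x, y), x ⋆ y)` make `A × G` a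
multiplicative Lie algebra with identity element `(1, 1)`. -/
structure IsCocycle {G : Type*} [MulLieAlgebra G] {A : Type*} [CommGroup A]
    (f h : G → G → A) : Prop where
  one_left : ∀ x, f 1 x = 1
  one_right : ∀ x, f x 1 = 1
  assoc : ∀ x y z, f x y * f (x * y) z = f y z * f x (y * z)
  lie_self : ∀ x, h x x = 1
  lie_mul : ∀ x y z, h x (y * z) =
    h x y * (h x z * conjFactor f y (x ⋆ z)) * f (x ⋆ y) (y * (x ⋆ z) * y⁻¹)
  mul_lie : ∀ x y z, h (x * y) z =
    (h y z * conjFactor f x (y ⋆ z)) * h x z * f (x * (y ⋆ z) * x⁻¹) (x ⋆ z)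
  jacobi : ∀ x y z,
    h (x ⋆ y) (y * z * y⁻¹) * h (y ⋆ z) (z * x * z⁻¹) * h (z ⋆ x) (x * y * x⁻¹) *
      f ((x ⋆ y) ⋆ (y * z * y⁻¹)) ((y ⋆ z) ⋆ (z * x * z⁻¹)) *
      f (((x ⋆ y) ⋆ (y * z * y⁻¹)) * ((y ⋆ z) ⋆ (z * x * z⁻¹)))
        ((z ⋆ x) ⋆ (x * y * x⁻¹)) = 1
  conj_lie : ∀ x y z,
    h x y * conjFactor f z (x ⋆ y) = h (z * x * z⁻¹) (z * y * z⁻¹)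

/-- The group `Z²_ML(G, A)` of 2-cocycles under pointwise multiplication. -/
def Z2 : Subgroup ((G → G → A) × (G → G → A)) where
  carrier := {p | IsCocycle p.1 p.2}
  one_mem' := by
    constructor <;> intros <;> simp [conjFactor]
  mul_mem' := by
    rintro ⟨f, h⟩ ⟨f', h'⟩ c c'
    have e : ∀ x y, conjFactor (f * f') x y = conjFactor f x y * conjFactor f' x y := by
      intro x y; simp only [conjFactor, Pi.mul_apply, mul_inv]; ac_rfl
    constructor
    · intro x; simpa using congrArg₂ (· * ·) (c.one_left x) (c'.one_left x)
    · intro x; simpa using congrArg₂ (· * ·) (c.one_right x) (c'.one_right x)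
    · intro x y z
      have := congrArg₂ (· * ·) (c.assoc x y z) (c'.assoc x y z)
      simp only [Prod.mk_mul_mk, Pi.mul_apply] at this ⊢
      rw [mul_mul_mul_comm, this, mul_mul_mul_comm]
    · intro x; simpa using congrArg₂ (· * ·) (c.lie_self x) (c'.lie_self x)
    · intro x y z
      have := congrArg₂ (· * ·) (c.lie_mul x y z) (c'.lie_mul x y z)
      simp only [Prod.mk_mul_mk, Pi.mul_apply, e] at this ⊢
      rw [this]; ac_rfl
    · intro x y z
      have := congrArg₂ (· * ·) (c.mul_lie x y z) (c'.mul_lie x y z)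
      simp only [Prod.mk_mul_mk, Pi.mul_apply, e] at this ⊢
      rw [this]; ac_rfl
    · intro x y z
      have := congrArg₂ (· * ·) (c.jacobi x y z) (c'.jacobi x y z)
      simp only [Prod.mk_mul_mk, Pi.mul_apply, mul_one] at this ⊢
      rw [← this]; ac_rfl
    · intro x y z
      have := congrArg₂ (· * ·) (c.conj_lie x y z) (c'.conj_lie x y z)
      simp only [Prod.mk_mul_mk, Pi.mul_apply, e] at this ⊢
      rw [← this]; ac_rfl
  inv_mem' := by
    rintro ⟨f, h⟩ c
    have e : ∀ x y, conjFactor f⁻¹ x y = (conjFactor f x y)⁻¹ := by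
      intro x y; simp only [conjFactor, Pi.inv_apply, mul_inv]
    constructor
    · intro x; simpa using c.one_left x
    · intro x; simpa using c.one_right x
    · intro x y z
      have := congrArg (·⁻¹) (c.assoc x y z)
      simpa only [Prod.inv_mk, Pi.inv_apply, mul_inv] using this
    · intro x; simpa using c.lie_self x
    · intro x y z
      have := congrArg (·⁻¹) (c.lie_mul x y z)
      simpa only [Prod.inv_mk, Pi.inv_apply, e, mul_inv] using this
    · intro x y z
      have := congrArg (·⁻¹) (c.mul_lie x y z)
      simpa only [Prod.inv_mk, Pi.inv_apply, e, mul_inv] using this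
    · intro x y z
      have := congrArg (·⁻¹) (c.jacobi x y z)
      simpa only [Prod.inv_mk, Pi.inv_apply, mul_inv, inv_one] using this
    · intro x y z
      have := congrArg (·⁻¹) (c.conj_lie x y z)
      simpa only [Prod.inv_mk, Pi.inv_apply, e, mul_inv] using this

/-- The group `B²_ML(G, A)` of 2-coboundaries: the pairs
`(x, y) ↦ g(x) g(y) g(xy)⁻¹`, `(x, y) ↦ g(x ⋆ y)⁻¹` with `g : G → A`, `g(1) = 1`. -/
def B2 : Subgroup ((G → G → A) × (G → G → A)) where
  carrier := {p | ∃ g : G → A, g 1 = 1 ∧ (∀ x y, p.1 x y = g x * g y * (g (x * y))⁻¹) ∧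
    ∀ x y, p.2 x y = (g (x ⋆ y))⁻¹}
  one_mem' := ⟨1, by simp⟩
  mul_mem' := by
    rintro p q ⟨g, hg, h1, h2⟩ ⟨g', hg', h1', h2'⟩
    refine ⟨g * g', by simp [hg, hg'], fun x y => ?_, fun x y => ?_⟩
    · simp only [Prod.fst_mul, Pi.mul_apply, h1, h1', mul_inv]; ac_rfl
    · simp only [Prod.snd_mul, Pi.mul_apply, h2, h2', mul_inv]
  inv_mem' := by
    rintro p ⟨g, hg, h1, h2⟩
    refine ⟨g⁻¹, by simp [hg], fun x y => ?_, fun x y => ?_⟩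
    · simp only [Prod.fst_inv, Pi.inv_apply, h1, mul_inv]
    · simp only [Prod.snd_inv, Pi.inv_apply, h2]

/-- The second cohomology group `H²_ML(G, A) = Z²_ML(G, A) / B²_ML(G, A)`
(coboundaries are cocycles). -/
abbrev H2 : Type _ := Z2 G A ⧸ (B2 G A).subgroupOf (Z2 G A)

end Cohomology

end MulLieAlgebra

namespace MulLieAlgebra

open scoped commutatorElement

/-! Everything rests on `eq_one_of_mem_mBracket`: if the multiplier of G is trivial, a central
extension E → G has kernel K meeting ᴹ[E,E] trivially. Lift a free presentation F → G, with kernel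
R, to F → E. The lift is onto modulo K, and central factors vanish from brackets, so ᴹ[F,F] maps
onto ᴹ[E,E]. An element of K ∩ ᴹ[E,E] thus comes from ᴹ[F,F] ∩ R = ᴹ[F,R], which lands in ᴹ[E,K] =
1.

For (i), let E be the extension defined by a cocycle. Then ᴹ[E,E] injects into G by the key lemma
and covers G by perfectness. It is therefore the image of a multiplicative Lie section, and its
A-coordinate exhibits the cocycle as a coboundary (`subsingleton_H2`).

For (ii), let F → G/N be the free presentation with kernel R, lifted to σ : F → G. Since σ kills
ᴹ[F,R], it induces a central extension F/ᴹ[F,R] → G. The key lemma makes this injective on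
ᴹ[F,F]/ᴹ[F,R], and perfectness makes it onto from there. The part lying over 1 in G/N is the
multiplier of G/N on one side and N on the other (`nonempty_iso_schurMultiplier`). The stem
condition is immediate from perfectness. -/

theorem one_lieMul {G : Type*} [MulLieAlgebra G] (x : G) : 1 ⋆ x = 1 := by
  rw [lieMul_swap x 1, lieMul_one, inv_one]

/-! ### Bracket ideals and central ideals -/

namespace Ideal

variable {G : Type*} [MulLieAlgebra G]

theorem mBracket_le {I : Ideal G} {K : Subgroup G}
    (hstar : ∀ g : G, ∀ h ∈ I.toSubgroup, g ⋆ h ∈ K) (hcomm : ∀ g : G, ∀ h ∈ I.toSubgroup, ⁅g, h⁆ ∈ K) :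
    I.mBracket.toSubgroup ≤ K := by
  refine sup_le ((Subgroup.closure_le _).mpr ?_)
    (Subgroup.commutator_le.mpr fun g _ h hh => hcomm g h hh)
  rintro _ ⟨g, h, hh, rfl⟩
  exact hstar g h hh

theorem lieMul_mem_mBracket (I : Ideal G) (g : G) {h : G} (hh : h ∈ I.toSubgroup) :
    g ⋆ h ∈ I.mBracket.toSubgroup :=
  (le_sup_left : starSubgroup I ≤ _) (Subgroup.subset_closure ⟨g, h, hh, rfl⟩)

theorem commutator_mem_mBracket (I : Ideal G) (g : G) {h : G} (hh : h ∈ I.toSubgroup) :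
    ⁅g, h⁆ ∈ I.mBracket.toSubgroup :=
  (le_sup_right : ⁅(⊤ : Subgroup G), I.toSubgroup⁆ ≤ I.mBracket.toSubgroup)
    (Subgroup.commutator_mem_commutator (Subgroup.mem_top g) hh)

namespace IsCentral

variable {I : Ideal G}

theorem comm (hI : I.IsCentral) {m : G} (hm : m ∈ I.toSubgroup) (x : G) : x * m = m * x :=
  Subgroup.mem_center_iff.mp (hI hm).1 x

theorem lieMul_left (hI : I.IsCentral) {m : G} (hm : m ∈ I.toSubgroup) (x : G) : m ⋆ x = 1 := (hI hm).2 x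

theorem lieMul_right (hI : I.IsCentral) {m : G} (hm : m ∈ I.toSubgroup) (x : G) : x ⋆ m = 1 := by
  rw [lieMul_swap m x, hI.lieMul_left hm, inv_one]

theorem commutator_right (hI : I.IsCentral) {m : G} (hm : m ∈ I.toSubgroup) (x : G) : ⁅x, m⁆ = 1 :=
  commutatorElement_eq_one_iff_mul_comm.mpr (hI.comm hm x)

theorem mul_lieMul_mul (hI : I.IsCentral) {m n : G} (hm : m ∈ I.toSubgroup) (hn : n ∈ I.toSubgroup) (x y : G) :
    (x * m) ⋆ (y * n) = x ⋆ y := by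
  rw [mul_lieMul, lieMul_mul x, hI.lieMul_left hm, hI.lieMul_right hn]
  group

theorem commutator_mul_mul (hI : I.IsCentral) {m n : G} (hm : m ∈ I.toSubgroup) (hn : n ∈ I.toSubgroup) (x y : G) :
    ⁅x * m, y * n⁆ = ⁅x, y⁆ := by
  -- After multiplication by `y * x` both sides become `x * y`: the central factors collect as the
  -- same `n * m` in both products and cancel.
  have h1 : ⁅x * m, y * n⁆ * (y * x) = ⁅x, y⁆ * (y * x) := by
    have e : (y * n) * (x * m) = (y * x) * (n * m) := by
      rw [mul_assoc, ← mul_assoc n, ← hI.comm hn x]; group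
    have e' : (x * m) * (y * n) = (x * y) * (n * m) := by
      rw [mul_assoc, ← mul_assoc m, ← hI.comm hm y, mul_assoc, hI.comm hn m]; group
    have e2 : ⁅x * m, y * n⁆ * ((y * n) * (x * m)) = (x * m) * (y * n) := by
      rw [commutatorElement_def]; group
    rw [e, e', ← mul_assoc] at e2
    rw [mul_right_cancel e2, commutatorElement_def]; group
  exact mul_right_cancel h1

theorem mBracket_eq_bot (hI : I.IsCentral) : I.mBracket.toSubgroup = ⊥ :=
  le_bot_iff.mp (mBracket_le (fun g _ hh => hI.lieMul_right hh g)
    fun g _ hh => hI.commutator_right hh g)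

end IsCentral

end Ideal

/-! ### Homomorphisms and their effect on brackets -/

namespace Hom

variable {F E : Type*} [MulLieAlgebra F] [MulLieAlgebra E] (σ : Hom F E)

theorem apply_lieMul (x y : F) : σ.toMonoidHom (x ⋆ y) = σ.toMonoidHom x ⋆ σ.toMonoidHom y :=
  σ.map_lieMul x y

theorem mem_ker {x : F} : x ∈ σ.ker.toSubgroup ↔ σ.toMonoidHom x = 1 := Iff.rfl

theorem map_mem_mBracket {I : Ideal F} {J : Ideal E}
    (h : ∀ x ∈ I.toSubgroup, σ.toMonoidHom x ∈ J.toSubgroup) {x : F}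
    (hx : x ∈ I.mBracket.toSubgroup) : σ.toMonoidHom x ∈ J.mBracket.toSubgroup := by
  refine (Ideal.mBracket_le (K := J.mBracket.toSubgroup.comap σ.toMonoidHom) ?_ ?_) hx
  · intro g y hy
    rw [Subgroup.mem_comap, apply_lieMul]
    exact J.lieMul_mem_mBracket _ (h y hy)
  · intro g y hy
    rw [Subgroup.mem_comap, map_commutatorElement]
    exact J.commutator_mem_mBracket _ (h y hy)

/-- A homomorphism that is surjective modulo a central ideal is surjective on `ᴹ[-, -]`. -/
theorem exists_mem_mBracket_whole {I : Ideal E} (hI : I.IsCentral)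
    (hσ : ∀ e : E, ∃ x : F, (σ.toMonoidHom x)⁻¹ * e ∈ I.toSubgroup) {e : E}
    (he : e ∈ (Ideal.whole E).mBracket.toSubgroup) :
    ∃ x ∈ (Ideal.whole F).mBracket.toSubgroup, σ.toMonoidHom x = e := by
  have key : ∀ e : E, ∃ x : F, ∃ m ∈ I.toSubgroup, e = σ.toMonoidHom x * m := fun e => by
    obtain ⟨x, hx⟩ := hσ e
    exact ⟨x, _, hx, by group⟩
  refine (Ideal.mBracket_le
    (K := (Ideal.whole F).mBracket.toSubgroup.map σ.toMonoidHom) ?_ ?_) he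
  · rintro a b -
    obtain ⟨x, m, hm, rfl⟩ := key a
    obtain ⟨y, n, hn, rfl⟩ := key b
    -- The central corrections `m`, `n` drop out, so this generator is exactly the image of a
    -- generator, not merely modulo `I`.
    rw [hI.mul_lieMul_mul hm hn, ← apply_lieMul]
    exact Subgroup.mem_map_of_mem _ ((Ideal.whole F).lieMul_mem_mBracket x (Subgroup.mem_top y))
  · rintro a b -
    obtain ⟨x, m, hm, rfl⟩ := key a
    obtain ⟨y, n, hn, rfl⟩ := key b
    rw [hI.commutator_mul_mul hm hn, ← map_commutatorElement]
    exact Subgroup.mem_map_of_mem _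
      ((Ideal.whole F).commutator_mem_mBracket x (Subgroup.mem_top y))

/-- The homomorphism induced on the quotient by an ideal contained in the kernel. -/
def quotientLift (I : Ideal F) (h : I.toSubgroup ≤ σ.ker.toSubgroup) :
    Hom (F ⧸ I.toSubgroup) E where
  toMonoidHom := QuotientGroup.lift I.toSubgroup σ.toMonoidHom h
  map_lieMul x y := by
    induction x using QuotientGroup.induction_on
    induction y using QuotientGroup.induction_on
    exact σ.map_lieMul _ _

end Hom

/-- The trivial ideal. -/
def Ideal.bot (G : Type*) [MulLieAlgebra G] : Ideal G where
  toSubgroup := ⊥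
  normal := inferInstance
  lieMul_mem x y hy := by
    rw [Subgroup.mem_bot] at hy ⊢
    rw [hy, lieMul_one]

/-- Lets `exists_mem_mBracket_whole` apply to homomorphisms that are genuinely surjective. -/
theorem Ideal.isCentral_bot (G : Type*) [MulLieAlgebra G] : (Ideal.bot G).IsCentral := by
  intro x hx
  obtain rfl : x = 1 := hx
  exact ⟨one_mem _, one_lieMul⟩

theorem Ideal.proj_ker {G : Type*} [MulLieAlgebra G] (N : Ideal G) : N.proj.ker = N := by
  have h : N.proj.ker.toSubgroup = N.toSubgroup := QuotientGroup.ker_mk' N.toSubgroup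
  cases N
  simp only [Hom.ker] at h ⊢
  congr

/-- Uniqueness in the universal property: both sides are evaluations of the same formal expression,
compared by induction on it. It makes a lift of a free presentation commute with the projection. -/
theorem Free.hom_lift {X G H : Type*} [MulLieAlgebra G] [MulLieAlgebra H] (φ : Hom G H)
    (s : X → G) (t : X → H) (hst : ∀ x, φ.toMonoidHom (s x) = t x) (w : Free X) :
    φ.toMonoidHom ((Free.lift s).toMonoidHom w) = (Free.lift t).toMonoidHom w := by
  obtain ⟨a⟩ := w
  change φ.toMonoidHom (a.eval s) = a.eval t
  induction a with
  | of x => exact hst x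
  | one => exact map_one _
  | mul a b iha ihb => simp only [FreeTerm.eval, map_mul, iha, ihb]
  | inv a iha => simp only [FreeTerm.eval, map_inv, iha]
  | lie a b iha ihb => simp only [FreeTerm.eval, Hom.apply_lieMul, iha, ihb]

theorem Free.lift_of {X G : Type*} [MulLieAlgebra G] (s : X → G) (x : X) :
    (Free.lift s).toMonoidHom (Free.of x) = s x := rfl

/-! ### Central extensions and the Schur multiplier -/

theorem mem_mBracket_of_subsingleton_hopfQuotient {F G : Type*} [MulLieAlgebra F]
    [MulLieAlgebra G] {π : Hom F G} (h : Subsingleton (HopfQuotient π)) {x : F}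
    (hx : x ∈ (Ideal.whole F).mBracket.toSubgroup) (hx' : π.toMonoidHom x = 1) :
    x ∈ π.ker.mBracket.toSubgroup := by
  let y : ((Ideal.whole F).mBracket.inter π.ker).toSubgroup := ⟨x, hx, hx'⟩
  have hy : (QuotientGroup.mk y : HopfQuotient π) = 1 := Subsingleton.elim _ _
  exact Subgroup.mem_subgroupOf.mp ((QuotientGroup.eq_one_iff y).mp hy)

/-- A central extension of an algebra with trivial Schur multiplier has kernel meeting
`ᴹ[E, E]` trivially. -/
theorem eq_one_of_mem_mBracket {E G : Type*} [MulLieAlgebra E] [MulLieAlgebra G]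
    (hM : Subsingleton (SchurMultiplier G)) (φ : Hom E G)
    (hφ : Function.Surjective φ.toMonoidHom) (hc : φ.ker.IsCentral) {e : E}
    (he : e ∈ (Ideal.whole E).mBracket.toSubgroup) (he' : φ.toMonoidHom e = 1) : e = 1 := by
  obtain ⟨s, hs⟩ := hφ.hasRightInverse
  let ρ : Hom (Free G) E := Free.lift s
  have hρ : ∀ w, φ.toMonoidHom (ρ.toMonoidHom w) = (Free.lift (id : G → G)).toMonoidHom w :=
    Free.hom_lift φ s id hs
  obtain ⟨x, hx, rfl⟩ := ρ.exists_mem_mBracket_whole hc (fun e => ⟨Free.of (φ.toMonoidHom e), by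
    rw [Hom.mem_ker, map_mul, map_inv, hρ, Free.lift_of, id, inv_mul_cancel]⟩) he
  have h1 := mem_mBracket_of_subsingleton_hopfQuotient hM hx ((hρ x).symm.trans he')
  have h2 : ρ.toMonoidHom x ∈ φ.ker.mBracket.toSubgroup :=
    ρ.map_mem_mBracket (I := (Free.lift id).ker) (J := φ.ker) (fun y hy => (hρ y).trans hy) h1
  rwa [hc.mBracket_eq_bot, Subgroup.mem_bot] at h2

theorem mk_mem_mBracket_whole {G : Type*} [MulLieAlgebra G] (I : Ideal G) {x : G}
    (hx : x ∈ (Ideal.whole G).mBracket.toSubgroup) :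
    I.proj.toMonoidHom x ∈ (Ideal.whole (G ⧸ I.toSubgroup)).mBracket.toSubgroup :=
  I.proj.map_mem_mBracket (I := Ideal.whole G) (J := Ideal.whole _) (fun _ _ => trivial) hx

/-- The kernel of a central extension `E → H` of a perfect algebra `E` with trivial Schur
multiplier is the Schur multiplier of `H`. -/
theorem nonempty_iso_schurMultiplier {E H : Type*} [MulLieAlgebra E] [MulLieAlgebra H]
    (hperf : IsPerfect E) (hM : Subsingleton (SchurMultiplier E)) (φ : Hom E H)
    (hφ : Function.Surjective φ.toMonoidHom) (hc : φ.ker.IsCentral) :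
    Nonempty (Iso φ.ker.toSubgroup (SchurMultiplier H)) := by
  obtain ⟨s, hs⟩ := hφ.hasRightInverse
  let π : Hom (Free H) H := Free.lift id
  let σ : Hom (Free H) E := Free.lift s
  have hσ : ∀ w, φ.toMonoidHom (σ.toMonoidHom w) = π.toMonoidHom w := Free.hom_lift φ s id hs
  -- Perfectness enters here: every `e` lies in ᴹ[E,E], so it has a preimage already in ᴹ[F,F].
  have hsurj : ∀ e : E, ∃ x ∈ (Ideal.whole (Free H)).mBracket.toSubgroup,
      σ.toMonoidHom x = e := fun e => by
    refine σ.exists_mem_mBracket_whole hc (fun e => ⟨Free.of (φ.toMonoidHom e), ?_⟩)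
      (hperf.symm ▸ Subgroup.mem_top e)
    rw [Hom.mem_ker, map_mul, map_inv, hσ, Free.lift_of, id, inv_mul_cancel]
  have hker : π.ker.mBracket.toSubgroup ≤ σ.ker.toSubgroup := fun x hx => by
    have : σ.toMonoidHom x ∈ φ.ker.mBracket.toSubgroup :=
      σ.map_mem_mBracket (I := π.ker) (J := φ.ker) (fun y hy => (hσ y).trans hy) hx
    rwa [hc.mBracket_eq_bot, Subgroup.mem_bot] at this
  have hinj : ∀ x ∈ (Ideal.whole (Free H)).mBracket.toSubgroup, σ.toMonoidHom x = 1 →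
      x ∈ π.ker.mBracket.toSubgroup := fun x hx hx' => by
    -- The key lemma is applied to F/ᴹ[F,R] → E rather than to `φ`. Its kernel is central because
    -- ker σ ⊆ R, and brackets with R have been factored out.
    let τ := σ.quotientLift π.ker.mBracket hker
    refine (QuotientGroup.eq_one_iff x).mp
      (eq_one_of_mem_mBracket hM τ ?_ ?_ (mk_mem_mBracket_whole _ hx) hx')
    · intro e
      obtain ⟨y, -, hy⟩ := hsurj e
      exact ⟨QuotientGroup.mk y, hy⟩
    · intro y hy
      induction y using QuotientGroup.induction_on with
      | H y =>
        have hy' : y ∈ π.ker.toSubgroup := by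
          have h1 : σ.toMonoidHom y = 1 := hy
          rw [Hom.mem_ker, ← hσ, h1, map_one]
        refine ⟨Subgroup.mem_center_iff.mpr fun z => ?_, fun z => ?_⟩
        · induction z using QuotientGroup.induction_on with
          | H z =>
            refine commutatorElement_eq_one_iff_mul_comm.mp ?_
            exact (QuotientGroup.eq_one_iff ⁅z, y⁆).mpr
              (π.ker.commutator_mem_mBracket z hy')
        · induction z using QuotientGroup.induction_on with
          | H z =>
            refine (QuotientGroup.eq_one_iff (y ⋆ z)).mpr ?_
            rw [lieMul_swap z y]
            exact inv_mem (π.ker.lieMul_mem_mBracket z hy')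
  let D : Ideal (Free H) := (Ideal.whole (Free H)).mBracket.inter π.ker
  let α : Hom D.toSubgroup φ.ker.toSubgroup :=
    { toFun := fun x => ⟨σ.toMonoidHom (x : Free H), (hσ x).trans x.2.2⟩
      map_one' := Subtype.ext (map_one σ.toMonoidHom)
      map_mul' := fun x y => Subtype.ext (map_mul σ.toMonoidHom (x : Free H) y)
      map_lieMul := fun x y => Subtype.ext (σ.map_lieMul x y) }
  let β : Hom (SchurMultiplier H) φ.ker.toSubgroup :=
    α.quotientLift (π.ker.mBracket.restrict D) fun x hx => Subtype.ext (hker hx)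
  have hβ : Function.Bijective β.toMonoidHom := by
    constructor
    · refine (injective_iff_map_eq_one _).mpr fun x hx => ?_
      induction x using QuotientGroup.induction_on with
      | H x =>
        exact (QuotientGroup.eq_one_iff x).mpr
          (hinj x x.2.1 (congrArg Subtype.val hx))
    · rintro ⟨e, he⟩
      obtain ⟨x, hx, rfl⟩ := hsurj e
      exact ⟨QuotientGroup.mk ⟨x, hx, (hσ x).symm.trans he⟩, rfl⟩
  let ε := MulEquiv.ofBijective β.toMonoidHom hβ
  refine ⟨⟨ε.symm, fun x y => ?_⟩⟩
  obtain ⟨x, rfl⟩ := ε.surjective x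
  obtain ⟨y, rfl⟩ := ε.surjective y
  change ε.symm (ε x ⋆ ε y) = ε.symm (ε x) ⋆ ε.symm (ε y)
  rw [ε.symm_apply_apply, ε.symm_apply_apply, ε.symm_apply_eq]
  exact (β.map_lieMul x y).symm

/-! ### The extension defined by a cocycle -/

/-- The underlying set `A × G` of the extension of `G` by `A` given by a cocycle. -/
@[ext]
structure CocycleExt {G A : Type*} [MulLieAlgebra G] [CommGroup A] {f h : G → G → A}
    (c : IsCocycle f h) where
  /-- the coordinate in the kernel -/
  fst : A
  /-- the coordinate in the quotient -/
  snd : G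

namespace CocycleExt

variable {G A : Type*} [MulLieAlgebra G] [CommGroup A] {f h : G → G → A} {c : IsCocycle f h}

instance : Group (CocycleExt c) where
  mul p q := ⟨p.fst * q.fst * f p.snd q.snd, p.snd * q.snd⟩
  one := ⟨1, 1⟩
  inv p := ⟨p.fst⁻¹ * (f p.snd⁻¹ p.snd)⁻¹, p.snd⁻¹⟩
  mul_assoc p q r := by
    refine CocycleExt.ext ?_ (mul_assoc p.snd q.snd r.snd)
    change p.fst * q.fst * f p.snd q.snd * r.fst * f (p.snd * q.snd) r.snd =
      p.fst * (q.fst * r.fst * f q.snd r.snd) * f p.snd (q.snd * r.snd)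
    calc _ = p.fst * q.fst * r.fst * (f p.snd q.snd * f (p.snd * q.snd) r.snd) := by ac_rfl
      _ = _ := by rw [c.assoc]; ac_rfl
  one_mul p := by
    refine CocycleExt.ext ?_ (one_mul p.snd)
    change 1 * p.fst * f 1 p.snd = p.fst
    rw [c.one_left, one_mul, mul_one]
  mul_one p := by
    refine CocycleExt.ext ?_ (mul_one p.snd)
    change p.fst * 1 * f p.snd 1 = p.fst
    rw [c.one_right, mul_one, mul_one]
  inv_mul_cancel p := by
    refine CocycleExt.ext ?_ (inv_mul_cancel p.snd)
    change p.fst⁻¹ * (f p.snd⁻¹ p.snd)⁻¹ * p.fst * f p.snd⁻¹ p.snd = 1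
    rw [mul_right_comm p.fst⁻¹, inv_mul_cancel, one_mul, inv_mul_cancel]

theorem mul_fst (p q : CocycleExt c) : (p * q).fst = p.fst * q.fst * f p.snd q.snd := rfl

theorem mul_snd (p q : CocycleExt c) : (p * q).snd = p.snd * q.snd := rfl

theorem inv_fst (p : CocycleExt c) : p⁻¹.fst = p.fst⁻¹ * (f p.snd⁻¹ p.snd)⁻¹ := rfl

theorem inv_snd (p : CocycleExt c) : p⁻¹.snd = p.snd⁻¹ := rfl

theorem conj_fst (p q : CocycleExt c) :
    (p * q * p⁻¹).fst = q.fst * conjFactor f p.snd q.snd := by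
  -- Associativity at (x, x⁻¹, x) gives f(x, x⁻¹) = f(x⁻¹, x). The inverse in the extension uses the
  -- latter, `conjFactor` the former.
  have e := c.assoc p.snd p.snd⁻¹ p.snd
  rw [mul_inv_cancel, inv_mul_cancel, c.one_left, c.one_right, mul_one, mul_one] at e
  rw [mul_fst, mul_fst, inv_fst, mul_snd, inv_snd, conjFactor, e]
  calc _ = p.fst * p.fst⁻¹ * (q.fst * (f p.snd q.snd * f (p.snd * q.snd) p.snd⁻¹ *
      (f p.snd⁻¹ p.snd)⁻¹)) := by ac_rfl
    _ = _ := by rw [mul_inv_cancel, one_mul]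

instance : MulLieAlgebra (CocycleExt c) where
  lieMul p q := ⟨h p.snd q.snd, p.snd ⋆ q.snd⟩
  lieMul_self p := CocycleExt.ext (c.lie_self p.snd) (lieMul_self p.snd)
  lieMul_mul p q r := by
    refine CocycleExt.ext ?_ (lieMul_mul p.snd q.snd r.snd)
    rw [mul_fst, conj_fst]
    exact c.lie_mul p.snd q.snd r.snd
  mul_lieMul p q r := by
    refine CocycleExt.ext ?_ (mul_lieMul p.snd q.snd r.snd)
    rw [mul_fst, conj_fst]
    exact c.mul_lie p.snd q.snd r.snd
  jacobi p q r := by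
    refine CocycleExt.ext ?_ (MulLieAlgebra.jacobi p.snd q.snd r.snd)
    rw [mul_fst, mul_fst]
    refine Eq.trans ?_ (c.jacobi p.snd q.snd r.snd)
    -- The group product puts the first factor `f` before the third `h`; the cocycle identity has it
    -- after.
    rw [mul_right_comm (h (p.snd ⋆ q.snd) (q.snd * r.snd * q.snd⁻¹) *
      h (q.snd ⋆ r.snd) (r.snd * p.snd * r.snd⁻¹))]
    rfl
  conj_lieMul p q r := by
    refine CocycleExt.ext ?_ (conj_lieMul p.snd q.snd r.snd)
    rw [conj_fst]
    exact c.conj_lie p.snd q.snd r.snd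

variable (c) in
/-- The projection of the extension onto the quotient. -/
def projHom : Hom (CocycleExt c) G where
  toFun := CocycleExt.snd
  map_one' := rfl
  map_mul' _ _ := rfl
  map_lieMul _ _ := rfl

theorem projHom_surjective : Function.Surjective (projHom c).toMonoidHom := fun x => ⟨⟨1, x⟩, rfl⟩

/-- Only `f` is normalized by definition; for `h` this follows from `mul_lie` at 1 · 1, which reads
h(1, x) = h(1, x)². -/
theorem cocycle_one_left (c : IsCocycle f h) (x : G) : h 1 x = 1 := by
  have e := c.mul_lie 1 1 x
  simpa [one_lieMul, conjFactor, c.one_left, c.one_right] using e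

theorem projHom_ker_isCentral : (projHom c).ker.IsCentral := by
  rintro ⟨a, x⟩ hx
  obtain rfl : x = 1 := hx
  refine ⟨Subgroup.mem_center_iff.mpr fun p => CocycleExt.ext ?_ ?_, fun p =>
    CocycleExt.ext (cocycle_one_left c p.snd) ?_⟩
  · rw [mul_fst, mul_fst, c.one_left, c.one_right, mul_comm a]
  · rw [mul_snd, mul_snd, mul_one, one_mul]
  · exact one_lieMul p.snd

end CocycleExt

/-! ### Vanishing of the second cohomology -/

/-- The second cohomology of a perfect algebra with trivial Schur multiplier vanishes. -/
theorem subsingleton_H2 {G : Type*} [MulLieAlgebra G] (hperf : IsPerfect G)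
    (hM : Subsingleton (SchurMultiplier G)) (A : Type*) [CommGroup A] :
    Subsingleton (H2 G A) := by
  rw [QuotientGroup.subsingleton_iff, eq_top_iff]
  rintro ⟨⟨f, h⟩, c⟩ -
  rw [Subgroup.mem_subgroupOf]
  replace c : IsCocycle f h := c
  let E := CocycleExt c
  let φ : Hom E G := CocycleExt.projHom c
  let P : Subgroup E := (Ideal.whole E).mBracket.toSubgroup
  have hinj : ∀ p ∈ P, ∀ q ∈ P, p.snd = q.snd → p = q := fun p hp q hq hpq => by
    refine eq_of_mul_inv_eq_one (eq_one_of_mem_mBracket hM φ CocycleExt.projHom_surjective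
      CocycleExt.projHom_ker_isCentral (P.mul_mem hp (P.inv_mem hq)) ?_)
    change p.snd * q.snd⁻¹ = 1
    rw [hpq, mul_inv_cancel]
  have hsurj : ∀ x : G, ∃ a : A, (⟨a, x⟩ : E) ∈ P := fun x => by
    have hx : x ∈ (Ideal.whole G).mBracket.toSubgroup := hperf.symm ▸ Subgroup.mem_top x
    obtain ⟨p, hp, rfl⟩ := φ.exists_mem_mBracket_whole (Ideal.isCentral_bot G)
      (fun y => ⟨⟨1, y⟩, inv_mul_cancel y⟩) hx
    exact ⟨p.fst, hp⟩
  -- By `hinj` the lift x ↦ (a(x), x) into `P` is the only one. As `P` is closed under both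
  -- operations, the lift respects them, which gives `hmul` and `hlie`.
  choose a ha using hsurj
  have hmul : ∀ x y, a x * a y * f x y = a (x * y) := fun x y =>
    congrArg CocycleExt.fst (hinj _ (P.mul_mem (ha x) (ha y)) _ (ha (x * y)) rfl)
  have hlie : ∀ x y, h x y = a (x ⋆ y) := fun x y =>
    congrArg CocycleExt.fst
      (hinj _ ((Ideal.whole E).lieMul_mem_mBracket ⟨a x, x⟩ (h := ⟨a y, y⟩) trivial) _
        (ha (x ⋆ y)) rfl)
  have hone : 1 = a 1 := congrArg CocycleExt.fst (hinj _ P.one_mem _ (ha 1) rfl)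
  -- The inverse is needed because f(x, y) = a(xy) a(x)⁻¹ a(y)⁻¹ and h(x, y) = a(x ⋆ y), opposite to
  -- the coboundary convention.
  refine ⟨fun x => (a x)⁻¹, by simp [← hone], fun x y => ?_, fun x y => ?_⟩
  · change f x y = (a x)⁻¹ * (a y)⁻¹ * ((a (x * y))⁻¹)⁻¹
    rw [inv_inv, ← hmul x y, ← mul_inv, inv_mul_cancel_left]
  · change h x y = ((a (x ⋆ y))⁻¹)⁻¹
    rw [inv_inv, hlie]

end MulLieAlgebra

/-! ### The main theorem -/

theorem theoremP6 {G : Type*} [MulLieAlgebra G] [Finite G]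
    (hperf : MulLieAlgebra.IsPerfect G)
    (hM : Subsingleton (MulLieAlgebra.SchurMultiplier G)) :
    (∀ (A : Type*) [CommGroup A], Subsingleton (MulLieAlgebra.H2 G A)) ∧
    (∀ N : MulLieAlgebra.Ideal G, N.IsCentral →
      Nonempty (MulLieAlgebra.Iso N.toSubgroup
        (MulLieAlgebra.SchurMultiplier (G ⧸ N.toSubgroup))) ∧
      MulLieAlgebra.IsStemCover N.proj ∧
      MulLieAlgebra.IsCover G (G ⧸ N.toSubgroup)) := by
  refine ⟨fun A _ => MulLieAlgebra.subsingleton_H2 hperf hM A, fun N hN => ?_⟩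
  have hsurj : Function.Surjective N.proj.toMonoidHom := QuotientGroup.mk'_surjective _
  have hker := N.proj_ker
  have hc : N.proj.ker.IsCentral := hker.symm ▸ hN
  have hiso := MulLieAlgebra.nonempty_iso_schurMultiplier hperf hM N.proj hsurj hc
  have hstem : MulLieAlgebra.IsStemCover N.proj :=
    ⟨hsurj, hc, le_top.trans_eq (Eq.symm hperf), hiso⟩
  -- The Lie structure on the subgroup depends on the ideal itself, so the kernel is replaced by a
  -- variable ideal in order to transport along `hker`.
  have hiso' : ∀ M, N.proj.ker = M → Nonempty (MulLieAlgebra.Iso M.toSubgroup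
      (MulLieAlgebra.SchurMultiplier (G ⧸ N.toSubgroup))) := by
    rintro _ rfl
    exact hiso
  exact ⟨hiso' N hker, hstem, N.proj, hstem⟩
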